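/- Let $X$ be a Polish space and let $R \subseteq X \times X$ be a countable Borel equivalence relation on $X$ (that is, $R$ is an equivalence relation, a Borel subset of $X \times X$, and all its classes are countable). Let $c : R \to \mathbb{R}$ be an $R$-cocycle, i.e. a Borel measurable function with $c(x,z) = c(x,y) + c(y,z)$ whenever $(x,y),(y,z) \in R$. For a Borel probability measure $\mu$ on $X$, let $\nu_r$ and $\nu_s$ be the measures on the Borel subsets $C$ of $R$ given by $$\nu_r(C) = \int_X \bigl|\{(x',y') \in C : x' = x\}\bigr|\, d\mu(x), \qquad \nu_s = \theta_*\nu_r, \quad \theta(x,y) = (y,x).$$ The measure $\mu$ is called quasi-invariant under $R$ if $\mu(A) = 0$ implies $\mu(R(A)) = 0$ for every Borel set $A \subseteq X$, where $R(A) = \{y \in X : (x,y) \in R \text{ for some } x \in A\}$; in this case $\nu_r$ and $\nu_s$ are $\sigma$-finite and mutually absolutely continuous. The measure $\mu$ is called $(c,R)$-conformal if it is quasi-invariant under $R$ and $$\frac{d\nu_r}{d\nu_s}(x,y) = e^{-c(x,y)} \quad \text{for } \nu_r\text{-almost every } (x,y) \in R.$$ Let $G$ be a countable group of Borel automorphisms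 of $X$ (bijections $X \to X$ that are Borel measurable together with their inverses) which generates $R$, i.e. $R = \{(x,y) \in X \times X : y = g(x) \text{ for some } g \in G\}$. Then a Borel probability measure $\mu$ on $X$ is $(c,R)$-conformal if and only if, for every $\varphi \in G$, the pushforward $\varphi_*\mu$ is absolutely continuous with respect to $\mu$ and $$\frac{d\varphi_*\mu}{d\mu}(x) = e^{c(x,\varphi^{-1}(x))} \quad \text{for } \mu\text{-almost every } x \in X.$$ -/

import Mathlib

open MeasureTheory Set
open scoped ENNReal

namespace BorelRel

/-- Composition makes the Borel automorphisms of `X` (bijections of `X` that are measurable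
together with their inverses) a group. -/
instance instGroupAut (X : Type*) [MeasurableSpace X] : Group (X ≃ᵐ X) where
  mul f g := g.trans f
  one := MeasurableEquiv.refl X
  inv f := f.symm
  mul_assoc _ _ _ := rfl
  one_mul _ := rfl
  mul_one _ := rfl
  inv_mul_cancel f := MeasurableEquiv.ext (funext fun x => f.symm_apply_apply x)

/-- The equivalence relation `R`, as a subset of `X × X`. -/
def graph {X : Type*} (R : Setoid X) : Set (X × X) := {p | R p.1 p.2}

/-- `R` is a countable Borel equivalence relation. -/
structure IsCountableBorel {X : Type*} [MeasurableSpace X] (R : Setoid X) : Prop where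
  measurableSet_graph : MeasurableSet (graph R)
  countable_class : ∀ x, {y | R x y}.Countable

/-- The group `G` generates `R`: `R` is the orbit equivalence relation
`{(x, y) | y = g x for some g ∈ G}`. -/
def Generates {X : Type*} [MeasurableSpace X] (G : Subgroup (X ≃ᵐ X)) (R : Setoid X) : Prop :=
  graph R = {p | ∃ g ∈ G, p.2 = g p.1}

/-- The `R`-saturation of a set `A`. -/
def saturation {X : Type*} (R : Setoid X) (A : Set X) : Set X := ⋃ x ∈ A, {y | R x y}

/-- `μ` is quasi-invariant under `R`: saturations of Borel null sets are null. -/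
def QuasiInvariant {X : Type*} [MeasurableSpace X] (R : Setoid X) (μ : Measure X) : Prop :=
  ∀ A : Set X, MeasurableSet A → μ A = 0 → μ (saturation R A) = 0

/-- The flip map `(x, y) ↦ (y, x)` of `R`. -/
def flip {X : Type*} (R : Setoid X) (p : graph R) : graph R :=
  ⟨(p.1.2, p.1.1), R.symm p.2⟩

/-- The left counting measure `ν_r(C) = ∫ |r⁻¹{x} ∩ C| dμ(x)` on `R`, where `r (x, y) = x`:
the mixture over `μ` of the counting measures on the fibres of `r`
(see `leftCounting_apply` for the formula). -/
noncomputable def leftCounting {X : Type*} [MeasurableSpace X] (R : Setoid X) (μ : Measure X) :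
    Measure (graph R) :=
  μ.bind fun x => Measure.count.restrict {p : graph R | p.1.1 = x}

/-- The right counting measure `ν_s`: the pushforward of `ν_r` under the flip map. -/
noncomputable def rightCounting {X : Type*} [MeasurableSpace X] (R : Setoid X) (μ : Measure X) :
    Measure (graph R) :=
  (leftCounting R μ).map (flip R)

/-- The Radon-Nikodym derivative `D = dν_r / dν_s` of `μ` with respect to `R`. -/
noncomputable def rnDerivRel {X : Type*} [MeasurableSpace X] (R : Setoid X) (μ : Measure X) :
    graph R → ℝ≥0∞ :=
  (leftCounting R μ).rnDeriv (rightCounting R μ)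

/-- An `R`-cocycle: a measurable `c : R → ℝ` with `c (x, z) = c (x, y) + c (y, z)`. -/
structure IsCocycle {X : Type*} [MeasurableSpace X] (R : Setoid X) (c : graph R → ℝ) : Prop where
  measurable : Measurable c
  add : ∀ (x y z : X) (hxy : (x, y) ∈ graph R) (hyz : (y, z) ∈ graph R),
    c ⟨(x, z), R.trans hxy hyz⟩ = c ⟨(x, y), hxy⟩ + c ⟨(y, z), hyz⟩

/-- `μ` is `(c, R)`-conformal: it is quasi-invariant under `R`, and `D = exp (-c)` almost
everywhere on `R`. -/
def IsConformal {X : Type*} [MeasurableSpace X] (R : Setoid X) (c : graph R → ℝ)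
    (μ : Measure X) : Prop :=
  QuasiInvariant R μ ∧
    ∀ᵐ p ∂(leftCounting R μ), rnDerivRel R μ p = ENNReal.ofReal (Real.exp (-c p))

/-- If `G` generates `R` and `g ∈ G`, then `(x, g⁻¹ x) ∈ R`. -/
theorem Generates.mem_inv {X : Type*} [MeasurableSpace X] {G : Subgroup (X ≃ᵐ X)} {R : Setoid X}
    (h : Generates G R) {g : X ≃ᵐ X} (hg : g ∈ G) (x : X) : (x, g⁻¹ x) ∈ graph R := by
  rw [h]
  exact ⟨g⁻¹, G.inv_mem hg, rfl⟩

/-- The fibrewise counting measures depend measurably on the base point. -/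
theorem measurable_fibre {X : Type*} [TopologicalSpace X] [PolishSpace X]
    [MeasurableSpace X] [BorelSpace X] {G : Subgroup (X ≃ᵐ X)} [Countable G] {R : Setoid X}
    (h : Generates G R) :
    Measurable fun x : X =>
      (Measure.count : Measure (graph R)).restrict {p : graph R | p.1.1 = x} := by
  obtain ⟨g, hg⟩ := exists_surjective_nat G
  have hmem : ∀ n x, (x, (g n).1 x) ∈ graph R := fun n x => by
    rw [h]; exact ⟨(g n).1, (g n).2, rfl⟩
  let f : ℕ → X → graph R := fun n x => ⟨(x, (g n).1 x), hmem n x⟩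
  have hf : ∀ n, Measurable (f n) := fun n =>
    (measurable_id.prodMk (g n).1.measurable).subtype_mk
  let E : ℕ → Set X := fun n => {x | ∀ m < n, (g m).1 x ≠ (g n).1 x}
  have hE : ∀ n, MeasurableSet (E n) := fun n => by
    have : E n = ⋂ m, ⋂ (_ : m < n), {x | (g m).1 x = (g n).1 x}ᶜ := by
      ext x; simp [E]
    rw [this]
    exact MeasurableSet.iInter fun m => MeasurableSet.iInter fun _ =>
      (measurableSet_eq_fun (g m).1.measurable (g n).1.measurable).compl
  refine Measure.measurable_of_measurable_coe _ fun C hC => ?_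
  have key : ∀ x, (Measure.count : Measure (graph R)).restrict {p : graph R | p.1.1 = x} C
      = ∑' n, (E n ∩ f n ⁻¹' C).indicator (fun _ => (1 : ℝ≥0∞)) x := by
    intro x
    rw [Measure.restrict_apply hC]
    have hU : C ∩ {p : graph R | p.1.1 = x} = ⋃ n, {p | p = f n x ∧ x ∈ E n ∩ f n ⁻¹' C} := by
      ext p
      simp only [mem_inter_iff, mem_ofPred_eq, mem_iUnion, mem_preimage]
      constructor
      · rintro ⟨hpC, hpx⟩
        classical
        have hex : ∃ n, (g n).1 x = p.1.2 := by
          obtain ⟨k, hk, hkp⟩ := h.subset p.2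
          obtain ⟨n, hn⟩ := hg ⟨k, hk⟩
          exact ⟨n, by rw [hn, hkp, hpx]⟩
        have hpf : p = f (Nat.find hex) x :=
          Subtype.ext (Prod.ext hpx (Nat.find_spec hex).symm)
        refine ⟨Nat.find hex, hpf, fun m hm heq => Nat.find_min hex hm ?_, hpf ▸ hpC⟩
        rw [heq, Nat.find_spec hex]
      · rintro ⟨n, rfl, -, hC'⟩
        exact ⟨hC', rfl⟩
    rw [hU, measure_iUnion]
    · refine tsum_congr fun n => ?_
      by_cases hx : x ∈ E n ∩ f n ⁻¹' C
      · simp only [hx, and_true, indicator_of_mem]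
        exact Measure.count_singleton _
      · simp [hx]
    · intro m n hmn
      refine Set.disjoint_left.2 ?_
      rintro p ⟨hp1, hx1, -⟩ ⟨hp2, hx2, -⟩
      have heq : (g m).1 x = (g n).1 x :=
        congrArg (fun q : graph R => q.1.2) (hp1.symm.trans hp2)
      rcases lt_or_gt_of_ne hmn with hlt | hlt
      · exact hx2 m hlt heq
      · exact hx1 n hlt heq.symm
    · intro n
      by_cases hx : x ∈ E n ∩ f n ⁻¹' C
      · simp only [hx, and_true]
        exact measurableSet_singleton _
      · simp [hx]
  simp_rw [key]
  exact Measurable.tsum fun n =>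
    measurable_const.indicator ((hE n).inter (hf n hC))

/-- The defining formula of the left counting measure. -/
theorem leftCounting_apply {X : Type*} [TopologicalSpace X] [PolishSpace X]
    [MeasurableSpace X] [BorelSpace X] {G : Subgroup (X ≃ᵐ X)} [Countable G] {R : Setoid X}
    (h : Generates G R) (μ : Measure X) {C : Set (graph R)} (hC : MeasurableSet C) :
    leftCounting R μ C = ∫⁻ x, (({p : graph R | p.1.1 = x} ∩ C).encard : ℝ≥0∞) ∂μ := by
  have hfib : ∀ x, MeasurableSet {p : graph R | p.1.1 = x} := fun x =>
    (measurable_fst.comp measurable_subtype_coe) (measurableSet_singleton x)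
  rw [leftCounting, Measure.bind_apply hC (measurable_fibre h).aemeasurable]
  refine lintegral_congr fun x => ?_
  rw [Measure.restrict_apply hC, Measure.count_apply (hC.inter (hfib x)), inter_comm]

end BorelRel

namespace BorelRel

section

variable {X : Type*} [MeasurableSpace X] {R : Setoid X} {G : Subgroup (X ≃ᵐ X)}

/-! The graphs of `φ⁻¹`, for `φ ∈ G`, form a countable Borel cover of `R`, and the first projection
maps each of them bijectively onto `X`. Under this identification `ν_r` becomes `μ`
(`leftCounting_restrict_autGraph`) and `ν_s` becomes `φ_*μ` (`rightCounting_restrict_autGraph`).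
Hence `ν_s = e^c ν_r` holds exactly when `φ_*μ` has density `e^{c(x, φ⁻¹ x)}` for every `φ`
(`rightCounting_eq_withDensity_iff`). Since `e^c` is positive and finite, `ν_s = e^c ν_r` can be
inverted to `ν_r = e^{-c} ν_s`, which is conformality (`isConformal_iff`); σ-finiteness, piece by
piece, makes densities and Radon-Nikodym derivatives interchangeable. -/

/-- The section `x ↦ (x, φ⁻¹ x)` of the first coordinate projection `R → X`. -/
def Generates.lift (h : Generates G R) (φ : G) (x : X) : graph R :=
  ⟨(x, φ.1⁻¹ x), h.mem_inv φ.2 x⟩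

/-- The part of `R` lying on the graph of `φ⁻¹`. -/
def autGraph (R : Setoid X) (φ : X ≃ᵐ X) : Set (graph R) := {p | p.1.2 = φ⁻¹ p.1.1}

theorem Generates.measurable_lift (h : Generates G R) (φ : G) : Measurable (h.lift φ) :=
  (measurable_id.prodMk (φ.1⁻¹).measurable).subtype_mk

theorem measurable_flip : Measurable (flip R) :=
  ((measurable_snd.comp measurable_subtype_coe).prodMk
    (measurable_fst.comp measurable_subtype_coe)).subtype_mk

theorem Generates.iUnion_autGraph (h : Generates G R) :
    ⋃ φ : G, autGraph R φ.1 = univ := by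
  refine eq_univ_of_forall fun p => ?_
  obtain ⟨g, hg, hp⟩ := h.subset p.2
  refine mem_iUnion.2 ⟨⟨g⁻¹, G.inv_mem hg⟩, ?_⟩
  change p.1.2 = (g⁻¹)⁻¹ p.1.1
  rw [inv_inv, hp]

theorem sigmaFinite_of_autGraph [Countable G] (h : Generates G R) {ν : Measure (graph R)}
    (hν : ∀ φ : G, ν (autGraph R φ.1) < ∞) : SigmaFinite ν := by
  refine Measure.sigmaFinite_of_countable (S := range fun φ : G => autGraph R φ.1)
    (countable_range _) ?_ ?_
  · rintro _ ⟨φ, rfl⟩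
    exact hν φ
  · rw [sUnion_range, h.iUnion_autGraph]

/-- The first projection is a left inverse of the lift, so pushing forward along it recovers the
measure. -/
theorem Generates.map_lift_injective (h : Generates G R) (φ : G) :
    Function.Injective fun ν : Measure X => ν.map (h.lift φ) := by
  intro ν ν' hν
  have hfst : Measurable fun p : graph R => p.1.1 := measurable_fst.comp measurable_subtype_coe
  have := congrArg (fun ρ : Measure (graph R) => ρ.map fun p => p.1.1) hν
  simp only [Measure.map_map hfst (h.measurable_lift φ)] at this
  simpa [Function.comp_def, Generates.lift] using this

theorem withDensity_map {Y : Type*} [MeasurableSpace Y] (μ : Measure X) {j : X → Y}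
    (hj : Measurable j) {f : Y → ℝ≥0∞} (hf : Measurable f) :
    (μ.map j).withDensity f = (μ.withDensity (f ∘ j)).map j := by
  ext C hC
  rw [withDensity_apply _ hC, Measure.map_apply hj hC, withDensity_apply _ (hj hC),
    setLIntegral_map hC hf hj]
  rfl

/-! ### Quasi-invariance through the generating group -/

theorem saturation_eq_iUnion (h : Generates G R) (A : Set X) :
    saturation R A = ⋃ g : G, (g.1⁻¹ : X ≃ᵐ X) ⁻¹' A := by
  ext y
  simp only [saturation, mem_iUnion]
  constructor
  · rintro ⟨x, hx, hxy⟩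
    obtain ⟨g, hg, hp⟩ := h.subset (show (x, y) ∈ graph R from hxy)
    refine ⟨⟨g, hg⟩, ?_⟩
    change g.symm y ∈ A
    rw [show y = g x from hp, g.symm_apply_apply]
    exact hx
  · rintro ⟨g, hg⟩
    exact ⟨_, hg, R.symm (h.mem_inv g.2 y)⟩

/-- Quasi-invariance under `R` is quasi-invariance under each element of a generating group. -/
theorem quasiInvariant_iff [Countable G] (h : Generates G R) (μ : Measure X) :
    QuasiInvariant R μ ↔ ∀ φ : G, μ.map φ.1 ≪ μ := by
  constructor
  · refine fun hμ φ => Measure.AbsolutelyContinuous.mk fun A hA h0 => ?_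
    rw [Measure.map_apply φ.1.measurable hA]
    refine measure_mono_null ?_ (hμ A hA h0)
    rw [saturation_eq_iUnion h]
    refine fun x hx => mem_iUnion.2 ⟨φ⁻¹, ?_⟩
    change ((φ.1⁻¹)⁻¹ : X ≃ᵐ X) x ∈ A
    rwa [inv_inv]
  · intro hμ A hA h0
    rw [saturation_eq_iUnion h]
    refine measure_iUnion_null fun g => ?_
    have := hμ g⁻¹ h0
    rwa [Measure.map_apply (g⁻¹).1.measurable hA] at this

/-- Push the hypothesis for `φ⁻¹` forward along `φ`. -/
theorem absolutelyContinuous_map {μ : Measure X} (hμ : ∀ φ : G, μ.map φ.1 ≪ μ) (φ : G) :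
    μ ≪ μ.map φ.1 := by
  have := (hμ φ⁻¹).map φ.1.measurable
  rw [Measure.map_map φ.1.measurable (φ⁻¹).1.measurable] at this
  have hid : (φ.1 ∘ (φ⁻¹).1 : X → X) = id := funext fun x => φ.1.apply_symm_apply x
  rwa [hid, Measure.map_id] at this

/-! ### Exponential densities and Radon-Nikodym derivatives -/

/-- The exponential of a cocycle, as a density on `R`. -/
noncomputable def expDensity (c : graph R → ℝ) (p : graph R) : ℝ≥0∞ :=
  ENNReal.ofReal (Real.exp (c p))

theorem measurable_expDensity {c : graph R → ℝ} (hc : Measurable c) :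
    Measurable (expDensity c) :=
  (Real.measurable_exp.comp hc).ennreal_ofReal

theorem withDensity_expDensity_neg {ν : Measure (graph R)} {c : graph R → ℝ}
    (hc : Measurable c) :
    (ν.withDensity (expDensity c)).withDensity (expDensity (-c)) = ν := by
  rw [← withDensity_mul _ (measurable_expDensity hc) (measurable_expDensity hc.neg)]
  convert withDensity_one using 2
  ext p
  simp [expDensity, ← ENNReal.ofReal_mul (Real.exp_nonneg _), ← Real.exp_add]

theorem eq_withDensity_expDensity_iff {ν ν' : Measure (graph R)} {c : graph R → ℝ}
    (hc : Measurable c) :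
    ν = ν'.withDensity (expDensity (-c)) ↔ ν' = ν.withDensity (expDensity c) := by
  constructor
  · rintro rfl
    simpa using (withDensity_expDensity_neg (ν := ν') hc.neg).symm
  · rintro rfl
    exact (withDensity_expDensity_neg hc).symm

/-- A measure is given by a density exactly when it is absolutely continuous with that density as
Radon-Nikodym derivative. -/
theorem eq_withDensity_iff_rnDeriv {Y : Type*} [MeasurableSpace Y] {ν ν' : Measure Y}
    [SigmaFinite ν] [SigmaFinite ν'] {f : Y → ℝ≥0∞} (hf : Measurable f) :
    ν' = ν.withDensity f ↔ ν' ≪ ν ∧ ν'.rnDeriv ν =ᵐ[ν] f := by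
  constructor
  · rintro rfl
    exact ⟨withDensity_absolutelyContinuous _ _, Measure.rnDeriv_withDensity _ hf⟩
  · rintro ⟨hac, hae⟩
    rw [← withDensity_congr_ae hae, Measure.withDensity_rnDeriv_eq _ _ hac]

end

/-! ### The counting measures on the graphs of the automorphisms -/

section

variable {X : Type*} [TopologicalSpace X] [PolishSpace X] [MeasurableSpace X] [BorelSpace X]
  {R : Setoid X} {G : Subgroup (X ≃ᵐ X)}

theorem measurableSet_autGraph (φ : X ≃ᵐ X) : MeasurableSet (autGraph R φ) :=
  measurableSet_eq_fun (measurable_snd.comp measurable_subtype_coe)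
    ((φ⁻¹).measurable.comp (measurable_fst.comp measurable_subtype_coe))

variable [Countable G]

/-- The fibre over `x` meets the graph of `φ⁻¹` only in `h.lift φ x`, so the fibre count is an
indicator function. -/
theorem leftCounting_restrict_autGraph (h : Generates G R) (μ : Measure X) (φ : G) :
    (leftCounting R μ).restrict (autGraph R φ.1) = μ.map (h.lift φ) := by
  ext C hC
  rw [Measure.restrict_apply hC, leftCounting_apply h μ (hC.inter (measurableSet_autGraph _)),
    Measure.map_apply (h.measurable_lift φ) hC, ← lintegral_indicator_one (h.measurable_lift φ hC)]
  refine lintegral_congr fun x => ?_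
  by_cases hx : h.lift φ x ∈ C
  · have : {p : graph R | p.1.1 = x} ∩ (C ∩ autGraph R φ.1) = {h.lift φ x} := by
      ext p
      constructor
      · rintro ⟨h1, -, h2⟩
        refine Subtype.ext (Prod.ext h1 (Eq.trans h2 ?_))
        rw [show p.1.1 = x from h1]
        rfl
      · rintro rfl
        exact ⟨rfl, hx, rfl⟩
    rw [this, indicator_of_mem (show x ∈ h.lift φ ⁻¹' C from hx)]
    simp
  · have : {p : graph R | p.1.1 = x} ∩ (C ∩ autGraph R φ.1) = ∅ := by
      refine eq_empty_of_forall_notMem ?_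
      rintro p ⟨h1, hpC, h2⟩
      refine hx ?_
      have : h.lift φ x = p := by
        refine Subtype.ext (Prod.ext h1.symm (Eq.trans ?_ h2.symm))
        rw [show p.1.1 = x from h1]
        rfl
      rwa [this]
    rw [this, indicator_of_notMem (show x ∉ h.lift φ ⁻¹' C from hx)]
    simp

/-- The flip exchanges the graphs of `φ` and `φ⁻¹`, and carries `(x, φ x)` to `(φ x, x)`, the lift
by `φ` of the point `φ x`. -/
theorem rightCounting_restrict_autGraph (h : Generates G R) (μ : Measure X) (φ : G) :
    (rightCounting R μ).restrict (autGraph R φ.1) = (μ.map φ.1).map (h.lift φ) := by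
  have hpre : flip R ⁻¹' autGraph R φ.1 = autGraph R (φ⁻¹).1 := by
    ext p
    change p.1.1 = φ.1.symm p.1.2 ↔ p.1.2 = φ.1 p.1.1
    exact φ.1.toEquiv.eq_symm_apply.trans eq_comm
  rw [rightCounting, Measure.restrict_map measurable_flip (measurableSet_autGraph _), hpre,
    leftCounting_restrict_autGraph h, Measure.map_map measurable_flip (h.measurable_lift _),
    Measure.map_map (h.measurable_lift _) φ.1.measurable]
  congr 1
  funext x
  exact Subtype.ext (Prod.ext rfl (φ.1.symm_apply_apply x).symm)

theorem sigmaFinite_leftCounting (h : Generates G R) (μ : Measure X) [IsFiniteMeasure μ] :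
    SigmaFinite (leftCounting R μ) := by
  refine sigmaFinite_of_autGraph h fun φ => ?_
  rw [← Measure.restrict_apply_univ, leftCounting_restrict_autGraph h]
  exact measure_lt_top _ _

theorem sigmaFinite_rightCounting (h : Generates G R) (μ : Measure X) [IsFiniteMeasure μ] :
    SigmaFinite (rightCounting R μ) := by
  refine sigmaFinite_of_autGraph h fun φ => ?_
  rw [← Measure.restrict_apply_univ, rightCounting_restrict_autGraph h]
  exact measure_lt_top _ _

/-- A density of `ν_s` with respect to `ν_r` is the same as a compatible family of densities of the
translates of `μ` by a generating group. -/
theorem rightCounting_eq_withDensity_iff (h : Generates G R) (μ : Measure X)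
    {f : graph R → ℝ≥0∞} (hf : Measurable f) :
    rightCounting R μ = (leftCounting R μ).withDensity f ↔
      ∀ φ : G, μ.map φ.1 = μ.withDensity (f ∘ h.lift φ) := by
  -- The pieces may overlap: agreement on each member of a countable cover already forces equality.
  rw [Measure.ext_iff_of_iUnion_eq_univ h.iUnion_autGraph]
  refine forall_congr' fun φ => ?_
  rw [restrict_withDensity (measurableSet_autGraph _), rightCounting_restrict_autGraph h,
    leftCounting_restrict_autGraph h, withDensity_map _ (h.measurable_lift φ) hf]
  exact (h.map_lift_injective φ).eq_iff

theorem absolutelyContinuous_of_autGraph (h : Generates G R) {ν ν' : Measure (graph R)}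
    (hν : ∀ φ : G, ν.restrict (autGraph R φ.1) ≪ ν'.restrict (autGraph R φ.1)) : ν ≪ ν' := by
  intro C hC
  rw [← inter_univ C, ← h.iUnion_autGraph, inter_iUnion]
  refine measure_iUnion_null fun φ => ?_
  rw [← Measure.restrict_apply' (measurableSet_autGraph _)]
  exact hν φ (Measure.absolutelyContinuous_of_le Measure.restrict_le_self hC)

/-- A finite measure is conformal exactly when `ν_s` has density `exp c` with respect to `ν_r`. -/
theorem isConformal_iff (h : Generates G R) {c : graph R → ℝ} (hc : Measurable c)
    (μ : Measure X) [IsFiniteMeasure μ] :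
    IsConformal R c μ ↔
      rightCounting R μ = (leftCounting R μ).withDensity (expDensity c) := by
  have := sigmaFinite_leftCounting h μ
  have := sigmaFinite_rightCounting h μ
  constructor
  · rintro ⟨hq, hD⟩
    have hq := (quasiInvariant_iff h μ).1 hq
    have hrs : leftCounting R μ ≪ rightCounting R μ :=
        absolutelyContinuous_of_autGraph h fun φ => by
      rw [leftCounting_restrict_autGraph h, rightCounting_restrict_autGraph h]
      exact (absolutelyContinuous_map hq φ).map (h.measurable_lift φ)
    have hsr : rightCounting R μ ≪ leftCounting R μ :=
        absolutelyContinuous_of_autGraph h fun φ => by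
      rw [leftCounting_restrict_autGraph h, rightCounting_restrict_autGraph h]
      exact (hq φ).map (h.measurable_lift φ)
    rw [← eq_withDensity_expDensity_iff hc,
      eq_withDensity_iff_rnDeriv (measurable_expDensity hc.neg)]
    -- Conformality is stated `ν_r`-almost everywhere, whereas the density criterion needs
    -- `ν_s`-almost everywhere; `ν_s ≪ ν_r` bridges the two.
    exact ⟨hrs, hsr.ae_le hD⟩
  · intro heq
    refine ⟨(quasiInvariant_iff h μ).2 fun φ => ?_, ?_⟩
    · rw [(rightCounting_eq_withDensity_iff h μ (measurable_expDensity hc)).1 heq φ]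
      exact withDensity_absolutelyContinuous _ _
    · rw [← eq_withDensity_expDensity_iff hc,
        eq_withDensity_iff_rnDeriv (measurable_expDensity hc.neg)] at heq
      -- The opposite transfer, by `ν_r ≪ ν_s`.
      exact heq.1.ae_le heq.2

end

end BorelRel

theorem mainTheorem12 {X : Type*} [TopologicalSpace X] [PolishSpace X]
    [MeasurableSpace X] [BorelSpace X]
    (R : Setoid X) (hR : BorelRel.IsCountableBorel R)
    (G : Subgroup (X ≃ᵐ X)) [Countable G] (hG : BorelRel.Generates G R)
    (c : BorelRel.graph R → ℝ) (hc : BorelRel.IsCocycle R c)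
    (μ : Measure X) [IsProbabilityMeasure μ] :
    BorelRel.IsConformal R c μ ↔
      ∀ (φ : X ≃ᵐ X) (hφ : φ ∈ G),
        μ.map φ ≪ μ ∧
          ∀ᵐ x ∂μ, (μ.map φ).rnDeriv μ x =
            ENNReal.ofReal (Real.exp (c ⟨(x, φ⁻¹ x), hG.mem_inv hφ x⟩)) := by
  rw [BorelRel.isConformal_iff hG hc.measurable,
    BorelRel.rightCounting_eq_withDensity_iff hG μ (BorelRel.measurable_expDensity hc.measurable),
    Subtype.forall]
  refine forall₂_congr fun φ hφ => ?_
  have : IsFiniteMeasure (μ.map φ) := inferInstance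
  exact BorelRel.eq_withDensity_iff_rnDeriv
    ((BorelRel.measurable_expDensity hc.measurable).comp (hG.measurable_lift ⟨φ, hφ⟩))
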